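/- **Lemma (Asymptotic continuity).** All quantum systems are finite-dimensional (and nonzero), $\mathscr D(\mathcal H)$ denotes the density operators on $\mathcal H$, and divergences take values in $[-\infty,+\infty]$. For a density operator $\rho$ and a positive semidefinite operator $\sigma$ on the same system, and for $\alpha\in(0,1)$, let $$D_{\mathrm M}(\rho\|\sigma)=\sup_{(\mathcal X,M)} D(P_{\rho,M}\|P_{\sigma,M}),\qquad D_{\mathrm M,\alpha}(\rho\|\sigma)=\sup_{(\mathcal X,M)} D_\alpha(P_{\rho,M}\|P_{\sigma,M}),$$ where the suprema run over finite sets $\mathcal X$ and POVMs $M=(M_x)_{x\in\mathcal X}$, $P_{\rho,M}(x)=\mathrm{tr}[M_x\rho]$, $D(P\|Q)=\sum_x P(x)\log\frac{P(x)}{Q(x)}$ if $P\ll Q$ and $+\infty$ otherwise, and $D_\alpha(P\|Q)=\frac1{\alpha-1}\log\sum_x P(x)^\alpha Q(x)^{1-\alpha}$ (equal to $+\infty$ if and only if $P$ and $Q$ are mutually singular). For $\mathbb D\in\{D_{\mathrm M}\}\cup\{D_{\mathrm M,\alpha}:\alpha\in(0,1)\}$, a completely positive trace-preserving map $\mathcal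 N$ and a completely positive map $\mathcal M$, both from $AE$ to $B$, let $$\mathbb D^{\mathrm{mx}}(\mathcal N\|\mathcal M)=\sup_{\rho_{AR}}\ \inf_{\sigma_E,\omega_E\in\mathscr D(\mathcal H_E)}\mathbb D\big(\mathcal N_{AE\to B}(\rho_{AR}\otimes\sigma_E)\,\big\|\,\mathcal M_{AE\to B}(\rho_{AR}\otimes\omega_E)\big),$$ the supremum being over reference systems $R$ of arbitrary finite dimension and $\rho_{AR}\in\mathscr D(\mathcal H_A\otimes\mathcal H_R)$, and let $$\mathbb D^{\mathrm{mx},\infty}(\mathcal N\|\mathcal M)=\lim_{n\to\infty}\frac1n\,\mathbb D^{\mathrm{mx}}(\mathcal N^{\otimes n}\|\mathcal M^{\otimes n}),$$ where $\mathcal N^{\otimes n}$ and $\mathcal M^{\otimes n}$ are regarded as maps from $A^nE^n$ to $B^n$. Then for every completely positive trace-preserving $\mathcal N$ and every completely positive $\mathcal M$ from $AE$ to $B$, the limits defining $D_{\mathrm M,\alpha}^{\mathrm{mx},\infty}(\mathcal N\|\mathcal M)$ for all $\alpha\in(0,1)$ and $D_{\mathrm M}^{\mathrm{mx},\infty}(\mathcal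 N\|\mathcal M)$ exist in $[-\infty,+\infty]$, and $$\sup_{\alpha\in(0,1)}D_{\mathrm M,\alpha}^{\mathrm{mx},\infty}(\mathcal N\|\mathcal M)=D_{\mathrm M}^{\mathrm{mx},\infty}(\mathcal N\|\mathcal M).$$ -/

import Mathlib

open scoped ComplexOrder Matrix Kronecker CStarAlgebra MatrixOrder Matrix.Norms.L2Operator

universe u

noncomputable section

namespace JammerChannel

/-! Finite-dimensional quantum systems are given by finite index types `d`; operators on the
system are `Matrix d d ℂ`, and the composite of two systems has the product as its index type. -/

/-- `ρ` is a density operator. -/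
def IsDensity {d : Type*} [Fintype d] (ρ : Matrix d d ℂ) : Prop :=
  ρ.PosSemidef ∧ ρ.trace = 1

/-- A positive operator valued measure with outcome set `x`. -/
def IsPOVM {x d : Type*} [Fintype x] [Fintype d] [DecidableEq d] (M : x → Matrix d d ℂ) : Prop :=
  (∀ i, (M i).PosSemidef) ∧ ∑ i, M i = 1

/-- The measure `i ↦ tr[Mᵢ ρ]` on the outcome set induced by measuring `ρ` with `M`. -/
def measuredDist {x d : Type*} [Fintype d] (M : x → Matrix d d ℂ) (ρ : Matrix d d ℂ) (i : x) : ℝ :=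
  (M i * ρ).trace.re

open Classical in
/-- The classical relative entropy `∑ᵢ Pᵢ log (Pᵢ / Qᵢ)` of a probability vector `P` with respect
to a nonnegative vector `Q`; it is `+∞` unless `P ≪ Q`. -/
def classicalRelEntropy {x : Type*} [Fintype x] (P Q : x → ℝ) : EReal :=
  if ∀ i, Q i = 0 → P i = 0 then ((∑ i, P i * Real.log (P i / Q i) : ℝ) : EReal) else ⊤

open Classical in
/-- The classical Rényi divergence `(α - 1)⁻¹ log ∑ᵢ Pᵢ ^ α Qᵢ ^ (1 - α)` of order
`α ∈ (0,1) ∪ (1,∞)`. For `α < 1` it is `+∞` exactly if `P` and `Q` are mutually singular,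
for `α > 1` it is `+∞` exactly if `P` is not absolutely continuous with respect to `Q`. -/
def classicalRenyi {x : Type*} [Fintype x] (α : ℝ) (P Q : x → ℝ) : EReal :=
  if (α < 1 ∧ ∃ i, P i ≠ 0 ∧ Q i ≠ 0) ∨ (1 < α ∧ ∀ i, Q i = 0 → P i = 0) then
    (((α - 1)⁻¹ * Real.log (∑ i, P i ^ α * Q i ^ (1 - α)) : ℝ) : EReal)
  else ⊤

/-- A functional that assigns an extended real number to pairs of operators on every
finite-dimensional system. -/
abbrev DivFunctional : Type (u + 1) :=
  ∀ (d : Type u) [Fintype d] [DecidableEq d], Matrix d d ℂ → Matrix d d ℂ → EReal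

/-- The measured divergence: the supremum over all finite outcome sets and all POVMs. -/
def measuredDiv : DivFunctional.{u} := fun d _ _ ρ σ =>
  ⨆ (m : ℕ) (M : Fin m → Matrix d d ℂ) (_ : IsPOVM M),
    classicalRelEntropy (measuredDist M ρ) (measuredDist M σ)

/-- The measured Rényi divergence of order `α`. -/
def measuredRenyiDiv (α : ℝ) : DivFunctional.{u} := fun d _ _ ρ σ =>
  ⨆ (m : ℕ) (M : Fin m → Matrix d d ℂ) (_ : IsPOVM M),
    classicalRenyi α (measuredDist M ρ) (measuredDist M σ)

/-- `Φ` preserves the trace. -/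
def IsTracePreserving {p b : Type*} [Fintype p] [Fintype b]
    (Φ : Matrix p p ℂ →ₗ[ℂ] Matrix b b ℂ) : Prop :=
  ∀ X, (Φ X).trace = X.trace

/-- The map `Φ ⊗ id_r`, with the reference system `r` as the second tensor factor: `Φ` is applied
to each of the `r × r` many blocks. -/
def ampliate {p b : Type*} (r : Type*) (Φ : Matrix p p ℂ →ₗ[ℂ] Matrix b b ℂ) :
    Matrix (p × r) (p × r) ℂ →ₗ[ℂ] Matrix (b × r) (b × r) ℂ where
  toFun X := Matrix.of fun i j => Φ (Matrix.of fun k l => X (k, i.2) (l, j.2)) i.1 j.1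
  map_add' X Y := by
    ext i j
    exact congrFun (congrFun (Φ.map_add (Matrix.of fun k l => X (k, i.2) (l, j.2))
      (Matrix.of fun k l => Y (k, i.2) (l, j.2))) i.1) j.1
  map_smul' c X := by
    ext i j
    exact congrFun (congrFun
      (Φ.map_smul c (Matrix.of fun k l => X (k, i.2) (l, j.2))) i.1) j.1

theorem ampliate_kronecker {p b r : Type*} (Φ : Matrix p p ℂ →ₗ[ℂ] Matrix b b ℂ)
    (X : Matrix p p ℂ) (Y : Matrix r r ℂ) : ampliate r Φ (X ⊗ₖ Y) = Φ X ⊗ₖ Y := by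
  ext i j
  have h : (Matrix.of fun k l => (X ⊗ₖ Y) (k, i.2) (l, j.2)) = Y i.2 j.2 • X := by
    ext k l
    simp [Matrix.kroneckerMap_apply, mul_comm]
  simp only [ampliate, LinearMap.coe_mk, AddHom.coe_mk, Matrix.of_apply]
  rw [h, Φ.map_smul]
  simp [Matrix.kroneckerMap_apply, mul_comm]

/-- For a map `Φ` from the system `AE` to `B`, a state `ρ` of `AR` and a state `σ` of `E`, the
operator `(Φ ⊗ id_R) (ρ_AR ⊗ σ_E)` on the system `BR`. -/
def jammedOutput {a e b r : Type*} (Φ : Matrix (a × e) (a × e) ℂ →ₗ[ℂ] Matrix b b ℂ)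
    (ρ : Matrix (a × r) (a × r) ℂ) (σ : Matrix e e ℂ) : Matrix (b × r) (b × r) ℂ :=
  ampliate r Φ ((ρ ⊗ₖ σ).submatrix (fun i => ((i.1.1, i.2), i.1.2)) fun i => ((i.1.1, i.2), i.1.2))

/-- The minimax channel divergence induced by `Dv`: the supremum over all reference systems `R` of
finite dimension `k` and all states of `AR`, of the infimum over all pairs of states of `E`. -/
def minimaxDiv {a e : Type*} {b : Type u} [Fintype a] [Fintype e] [Fintype b] [DecidableEq b]
    (Dv : DivFunctional.{u}) (N M : Matrix (a × e) (a × e) ℂ →ₗ[ℂ] Matrix b b ℂ) : EReal :=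
  ⨆ (k : ℕ) (ρ : Matrix (a × Fin k) (a × Fin k) ℂ) (_ : IsDensity ρ),
    ⨅ (σ : Matrix e e ℂ) (_ : IsDensity σ) (ω : Matrix e e ℂ) (_ : IsDensity ω),
      Dv (b × Fin k) (jammedOutput N ρ σ) (jammedOutput M ρ ω)

/-- The `n`-fold tensor power of a linear map, given by its values on matrix units; the `n`-fold
tensor power of a system has the functions on `Fin n` as its index type. -/
def tensorPow {p b : Type*} [Fintype p] [DecidableEq p] (Φ : Matrix p p ℂ →ₗ[ℂ] Matrix b b ℂ)
    (n : ℕ) : Matrix (Fin n → p) (Fin n → p) ℂ →ₗ[ℂ] Matrix (Fin n → b) (Fin n → b) ℂ where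
  toFun X := Matrix.of fun i j =>
    ∑ k, ∑ l, X k l * ∏ t, Φ (Matrix.single (k t) (l t) 1) (i t) (j t)
  map_add' X Y := by
    ext i j
    simp [add_mul, Finset.sum_add_distrib]
  map_smul' c X := by
    ext i j
    simp [Finset.mul_sum, mul_assoc]

/-- On product operators `X₁ ⊗ ⋯ ⊗ Xₙ` the tensor power acts factorwise. -/
theorem tensorPow_prod {p b : Type*} [Fintype p] [DecidableEq p]
    (Φ : Matrix p p ℂ →ₗ[ℂ] Matrix b b ℂ) (n : ℕ) (X : Fin n → Matrix p p ℂ) :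
    tensorPow Φ n (Matrix.of fun k l => ∏ t, X t (k t) (l t)) =
      Matrix.of fun i j => ∏ t, Φ (X t) (i t) (j t) := by
  ext i j
  have h : ∀ t, Φ (X t) (i t) (j t) =
      ∑ k, ∑ l, X t k l * Φ (Matrix.single k l 1) (i t) (j t) := by
    intro t
    conv_lhs => rw [Matrix.matrix_eq_sum_single (X t)]
    simp only [map_sum, Matrix.sum_apply]
    refine Finset.sum_congr rfl fun k _ => Finset.sum_congr rfl fun l _ => ?_
    rw [← mul_one (X t k l), ← smul_eq_mul, ← Matrix.smul_single, Φ.map_smul]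
    simp
  simp only [tensorPow, LinearMap.coe_mk, AddHom.coe_mk, Matrix.of_apply, h]
  rw [Finset.prod_univ_sum, Fintype.piFinset_univ]
  refine Finset.sum_congr rfl fun k _ => ?_
  rw [Finset.prod_univ_sum, Fintype.piFinset_univ]
  exact Finset.sum_congr rfl fun l _ => Finset.prod_mul_distrib.symm

/-- The `n`-fold tensor power of a map from `AE` to `B`, as a map from `AⁿEⁿ` to `Bⁿ`. -/
def channelPow {a e b : Type*} [Fintype a] [DecidableEq a] [Fintype e] [DecidableEq e]
    (Φ : Matrix (a × e) (a × e) ℂ →ₗ[ℂ] Matrix b b ℂ) (n : ℕ) :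
    Matrix ((Fin n → a) × (Fin n → e)) ((Fin n → a) × (Fin n → e)) ℂ →ₗ[ℂ]
      Matrix (Fin n → b) (Fin n → b) ℂ :=
  tensorPow Φ n ∘ₗ
    (Matrix.reindexLinearEquiv ℂ ℂ (Equiv.arrowProdEquivProdArrow (Fin n) (fun _ => a) (fun _ => e)).symm
      (Equiv.arrowProdEquivProdArrow (Fin n) (fun _ => a) (fun _ => e)).symm).toLinearMap

/-- The normalized `n`-fold minimax channel divergence. -/
def minimaxDivRate {a e : Type*} {b : Type u} [Fintype a] [DecidableEq a] [Fintype e]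
    [DecidableEq e] [Fintype b] [DecidableEq b] (Dv : DivFunctional.{u})
    (N M : Matrix (a × e) (a × e) ℂ →ₗ[ℂ] Matrix b b ℂ) (n : ℕ) : EReal :=
  (((n : ℝ)⁻¹ : ℝ) : EReal) * minimaxDiv Dv (channelPow N n) (channelPow M n)

/-- The regularized minimax channel divergence, meaningful when the limit exists. -/
def regMinimaxDiv {a e : Type*} {b : Type u} [Fintype a] [DecidableEq a] [Fintype e]
    [DecidableEq e] [Fintype b] [DecidableEq b] (Dv : DivFunctional.{u})
    (N M : Matrix (a × e) (a × e) ℂ →ₗ[ℂ] Matrix b b ℂ) : EReal :=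
  Filter.limUnder Filter.atTop (minimaxDivRate Dv N M)

end JammerChannel

end

namespace JammerChannel

/-! Once every regularization is a supremum over `n ≥ 1`, the theorem is an exchange of two suprema.
This needs two facts: on a fixed number of uses the orders `α < 1` exhaust the measured relative
entropy, and the minimax divergence is superadditive.

Exhaustion (`minimaxDiv_measuredDiv_eq`): classical Rényi divergences increase to the relative
entropy as `α ↑ 1`. For fixed input `ρ` and real `c`, the pairs `(σ, ω)` for which some measurement
gives order-`α` divergence above `c` form an open condition that weakens as `α` grows. Pairs of
jammer states form a compact set, so a single `α` serves all of them.

Superadditivity (`minimaxDiv_superadditive`): feed in `ρ₁ ⊗ ρ₂` and measure adaptively. A possibly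
entangled jammer state acts on the first block through its marginal; given an outcome there, it acts
on the second block as some state. The second measurement may depend on that outcome and on `(σ,
ω)`, so no minimax theorem is needed. Fekete's lemma then makes each limit a supremum. -/

theorem ereal_le_of_forall_coe_lt {x y : EReal} (h : ∀ c : ℝ, (c : EReal) < x → (c : EReal) ≤ y) :
    x ≤ y := by
  refine le_of_forall_lt fun z hz => ?_
  obtain ⟨c, hzc, hcx⟩ := EReal.lt_iff_exists_real_btwn.1 hz
  exact hzc.trans_le (h c hcx)

/-! ### Classical Rényi divergence and its limit at order one. -/

section Classical

variable {x : Type*} [Fintype x]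

/-- The sum `∑ᵢ Pᵢ ^ α Qᵢ ^ (1 - α)`. -/
noncomputable def renyiSum (α : ℝ) (P Q : x → ℝ) : ℝ := ∑ i, P i ^ α * Q i ^ (1 - α)

/-- Mutually singular vectors have Rényi sum zero, so this criterion also covers the value `⊤`.
Later arguments use only this real-valued form. -/
theorem lt_classicalRenyi_iff {α : ℝ} (h0 : 0 < α) (h1 : α < 1) {P Q : x → ℝ} (hP : ∀ i, 0 ≤ P i)
    (hQ : ∀ i, 0 ≤ Q i) (c : ℝ) :
    (c : EReal) < classicalRenyi α P Q ↔ renyiSum α P Q < Real.exp ((α - 1) * c) := by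
  have hα : ¬ 1 < α := not_lt.2 h1.le
  unfold classicalRenyi renyiSum
  by_cases h : ∃ i, P i ≠ 0 ∧ Q i ≠ 0
  · have hpos : 0 < ∑ i, P i ^ α * Q i ^ (1 - α) := by
      obtain ⟨i, hi, hi'⟩ := h
      refine Finset.sum_pos' (fun j _ => mul_nonneg (Real.rpow_nonneg (hP j) _)
        (Real.rpow_nonneg (hQ j) _)) ⟨i, Finset.mem_univ _, mul_pos
        (Real.rpow_pos_of_pos ((hP i).lt_of_ne' hi) _)
        (Real.rpow_pos_of_pos ((hQ i).lt_of_ne' hi') _)⟩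
    rw [if_pos (Or.inl ⟨h1, h⟩), EReal.coe_lt_coe_iff, ← Real.log_lt_iff_lt_exp hpos,
      inv_mul_eq_div, lt_div_iff_of_neg (by linarith), mul_comm]
  · rw [if_neg (by simp [h, hα])]
    have hz : ∑ i, P i ^ α * Q i ^ (1 - α) = 0 := by
      refine Finset.sum_eq_zero fun i _ => ?_
      by_cases hi : P i = 0
      · rw [hi, Real.zero_rpow h0.ne', zero_mul]
      · have hi' : Q i = 0 := by
          by_contra hq
          exact h ⟨i, hi, hq⟩
        rw [hi', Real.zero_rpow (by linarith), mul_zero]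
    rw [hz]
    exact iff_of_true (EReal.coe_lt_top c) (Real.exp_pos _)

theorem renyi_term_eq {α p q : ℝ} (h0 : 0 < α) (hp : 0 ≤ p) (hq : 0 ≤ q) :
    p ^ α * q ^ (1 - α) = p * (q / p) ^ (1 - α) := by
  rcases hp.eq_or_lt with rfl | hp
  · rw [Real.zero_rpow h0.ne', zero_mul, zero_mul]
  · rw [Real.div_rpow hq hp.le, Real.rpow_sub hp, Real.rpow_one]
    field_simp

/-- Power mean inequality under `P`, applied to `(Q / P) ^ (1 - β)` with exponent `(1 - α) / (1 - β)
≥ 1`. -/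
theorem classicalRenyi_mono {α β : ℝ} (h0 : 0 < α) (h : α ≤ β) (h1 : β < 1) {P Q : x → ℝ}
    (hP : ∀ i, 0 ≤ P i) (hP1 : ∑ i, P i = 1) (hQ : ∀ i, 0 ≤ Q i) :
    classicalRenyi α P Q ≤ classicalRenyi β P Q := by
  refine ereal_le_of_forall_coe_lt fun c hc => ?_
  rw [lt_classicalRenyi_iff h0 (h.trans_lt h1) hP hQ] at hc
  refine ((lt_classicalRenyi_iff (h0.trans_le h) h1 hP hQ c).2 ?_).le
  have hβ : 0 < 1 - β := by linarith
  set p := (1 - α) / (1 - β) with hp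
  have hp1 : 1 ≤ p := by rw [hp, one_le_div hβ]; linarith
  have key : renyiSum β P Q ^ p ≤ renyiSum α P Q := by
    have := Real.rpow_arith_mean_le_arith_mean_rpow Finset.univ P
      (fun i => (Q i / P i) ^ (1 - β)) (fun i _ => hP i) hP1
      (fun i _ => Real.rpow_nonneg (div_nonneg (hQ i) (hP i)) _) hp1
    unfold renyiSum
    convert this using 2
    · exact Finset.sum_congr rfl fun i _ => renyi_term_eq (h0.trans_le h) (hP i) (hQ i)
    · rw [renyi_term_eq h0 (hP _) (hQ _), ← Real.rpow_mul (div_nonneg (hQ _) (hP _)), hp,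
        mul_div_cancel₀ _ hβ.ne']
  have hS : 0 ≤ renyiSum β P Q := Finset.sum_nonneg fun i _ =>
    mul_nonneg (Real.rpow_nonneg (hP i) _) (Real.rpow_nonneg (hQ i) _)
  have hlt : renyiSum β P Q ^ p < Real.exp ((β - 1) * c) ^ p := by
    rw [← Real.exp_mul]
    have : (β - 1) * c * p = (α - 1) * c := by rw [hp]; field_simp; ring
    rw [this]
    exact key.trans_lt hc
  exact (Real.rpow_lt_rpow_iff hS (Real.exp_pos _).le (by linarith)).1 hlt

/-- Jensen's inequality for `exp` under `P`, applied to `(1 - α) log (Q / P)`. -/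
theorem classicalRenyi_le_relEntropy {α : ℝ} (h0 : 0 < α) (h1 : α < 1) {P Q : x → ℝ}
    (hP : ∀ i, 0 ≤ P i) (hP1 : ∑ i, P i = 1) (hQ : ∀ i, 0 ≤ Q i) :
    classicalRenyi α P Q ≤ classicalRelEntropy P Q := by
  unfold classicalRelEntropy
  split_ifs with hac
  swap
  · exact le_top
  by_contra! hlt
  rw [lt_classicalRenyi_iff h0 h1 hP hQ] at hlt
  refine hlt.not_ge ?_
  have := convexOn_exp.map_sum_le (t := Finset.univ) (w := P)
    (p := fun i => (1 - α) * Real.log (Q i / P i)) (fun i _ => hP i) hP1 (fun i _ => Set.mem_univ _)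
  simp only [smul_eq_mul] at this
  convert this using 1
  · congr 1
    rw [Finset.mul_sum]
    refine Finset.sum_congr rfl fun i _ => ?_
    rw [← inv_div (P i), Real.log_inv]
    ring
  · refine Finset.sum_congr rfl fun i _ => ?_
    rw [renyi_term_eq h0 (hP i) (hQ i)]
    rcases (hP i).eq_or_lt with hi | hi
    · rw [← hi, zero_mul, zero_mul]
    · have hq : 0 < Q i := (hQ i).lt_of_ne' fun h => hi.ne' (hac i h)
      rw [Real.rpow_def_of_pos (div_pos hq hi), mul_comm (1 - α)]

theorem exists_lt_classicalRenyi {P Q : x → ℝ} (hP : ∀ i, 0 ≤ P i) (hP1 : ∑ i, P i = 1)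
    (hQ : ∀ i, 0 ≤ Q i) {c : ℝ} (hc : (c : EReal) < classicalRelEntropy P Q) :
    ∃ α ∈ Set.Ioo (0 : ℝ) 1, (c : EReal) < classicalRenyi α P Q := by
  classical
  set s : Finset x := Finset.univ.filter fun i => Q i ≠ 0 with hs
  -- Restricting to the support of `Q` gives a smooth extension of the Rényi sum to `α = 1`, where
  -- the power `0 ^ 0` would count the missing mass.
  set g : ℝ → ℝ := fun α => ∑ i ∈ s, P i * Real.exp ((1 - α) * Real.log (Q i / P i)) with hg
  have hgS : ∀ α ∈ Set.Ioo (0 : ℝ) 1, renyiSum α P Q = g α := by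
    intro α hα
    simp only [renyiSum, hg, hs, Finset.sum_filter]
    refine Finset.sum_congr rfl fun i _ => ?_
    rw [renyi_term_eq hα.1 (hP i) (hQ i)]
    split_ifs with hi
    · rcases (hP i).eq_or_lt with hi' | hi'
      · rw [← hi', zero_mul, zero_mul]
      · have hq : 0 < Q i := (hQ i).lt_of_ne' hi
        rw [Real.rpow_def_of_pos (div_pos hq hi'), mul_comm (1 - α)]
    · rw [not_not.1 hi, zero_div, Real.zero_rpow (by linarith [hα.2]), mul_zero]
  suffices h : ∀ᶠ α in nhdsWithin (1 : ℝ) (Set.Iio 1), g α < Real.exp ((α - 1) * c) by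
    have h2 : ∀ᶠ α in nhdsWithin (1 : ℝ) (Set.Iio 1), α ∈ Set.Ioo (0 : ℝ) 1 :=
      Ioo_mem_nhdsLT one_pos
    obtain ⟨α, h, hα⟩ := (h.and h2).exists
    exact ⟨α, hα, (lt_classicalRenyi_iff hα.1 hα.2 hP hQ c).2 (by rwa [hgS α hα])⟩
  by_cases hac : ∀ i, Q i = 0 → P i = 0
  · rw [classicalRelEntropy, if_pos hac, EReal.coe_lt_coe_iff] at hc
    -- The difference vanishes at `1` with derivative `D(P‖Q) - c > 0`, so it is negative just to
    -- the left.
    have hd : HasDerivAt (fun α => g α - Real.exp ((α - 1) * c))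
        (∑ i ∈ s, P i * (Real.exp ((1 - 1) * Real.log (Q i / P i)) *
          ((-1) * Real.log (Q i / P i))) - Real.exp ((1 - 1) * c) * (1 * c)) 1 := by
      refine HasDerivAt.sub (HasDerivAt.fun_sum fun i _ => HasDerivAt.const_mul _
        (HasDerivAt.exp (HasDerivAt.mul_const ?_ _)))
        (HasDerivAt.exp (HasDerivAt.mul_const ?_ _))
      · exact (hasDerivAt_id _).const_sub 1
      · exact (hasDerivAt_id _).sub_const 1
    have hsum : ∀ f : x → ℝ, ∑ i ∈ s, P i * f i = ∑ i, P i * f i := by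
      intro f
      refine Finset.sum_subset (Finset.subset_univ _) fun i _ hi => ?_
      have : Q i = 0 := by simpa [hs] using hi
      rw [hac i this, zero_mul]
    have hpos : 0 < ∑ i ∈ s, P i * (Real.exp ((1 - 1) * Real.log (Q i / P i)) *
          ((-1) * Real.log (Q i / P i))) - Real.exp ((1 - 1) * c) * (1 * c) := by
      rw [hsum]
      have : ∀ i, P i * (Real.exp ((1 - 1) * Real.log (Q i / P i)) *
          ((-1) * Real.log (Q i / P i))) = P i * Real.log (P i / Q i) := by
        intro i
        rw [← inv_div (P i), Real.log_inv]
        simp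
      simp only [this]
      simpa using hc
    have h1 : g 1 - Real.exp ((1 - 1) * c) = 0 := by
      have := hsum fun _ => 1
      simp only [mul_one] at this
      simp [hg, this, hP1]
    have := (hasDerivWithinAt_iff_tendsto_slope' (by simp)).1
      (hd.hasDerivWithinAt (s := Set.Iio 1))
    filter_upwards [this.eventually (lt_mem_nhds hpos), self_mem_nhdsWithin] with α hα hα1
    rw [slope_def_field, h1, sub_zero] at hα
    have hneg : α - 1 < 0 := sub_neg.2 hα1
    have := (div_pos_iff.1 hα).resolve_left fun h => by linarith [h.2]
    linarith [this.1]
  · push Not at hac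
    obtain ⟨i, hi, hi'⟩ := hac
    -- Without absolute continuity `g 1` is the `P`-mass of the support of `Q`, which is below `1`;
    -- continuity suffices.
    have hcont : ContinuousAt (fun α => Real.exp ((α - 1) * c) - g α) 1 := by
      refine Continuous.continuousAt ?_
      rw [hg]
      fun_prop
    have h1 : 0 < Real.exp ((1 - 1) * c) - g 1 := by
      have : g 1 < 1 := by
        have hg1 : g 1 = ∑ i ∈ s, P i := by simp [hg]
        rw [hg1, ← hP1]
        exact Finset.sum_lt_sum_of_subset (Finset.subset_univ _) (Finset.mem_univ i) (by simp [hs, hi])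
          ((hP i).lt_of_ne' hi') fun j _ _ => hP j
      simpa using this
    filter_upwards [nhdsWithin_le_nhds (hcont.eventually (lt_mem_nhds h1))] with α hα
    linarith

end Classical

/-! ### Limits of superadditive extended-real sequences. -/

section Fekete

/-- Fekete's lemma for superadditive sequences with values in `(-∞, ∞]`. -/
theorem tendsto_iSup_of_superadditive {f : ℕ → EReal} (hbot : ∀ n, f n ≠ ⊥)
    (hsup : ∀ m n (c d : ℝ), (c : EReal) < f m → (d : EReal) < f n →
      ((c + d : ℝ) : EReal) ≤ f (m + n)) :
    Filter.Tendsto (fun n : ℕ => (((n : ℝ)⁻¹ : ℝ) : EReal) * f n) Filter.atTop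
      (nhds (⨆ (n : ℕ) (_ : 1 ≤ n), (((n : ℝ)⁻¹ : ℝ) : EReal) * f n)) := by
  by_cases htop : ∃ m, f m = ⊤
  · obtain ⟨m, hm⟩ := htop
    -- One infinite value makes all later ones infinite, since `f (n - m)` is not `⊥`.
    have h1 : ∀ n, max m 1 ≤ n → (((n : ℝ)⁻¹ : ℝ) : EReal) * f n = ⊤ := by
      intro n hn
      have hfn : f n = ⊤ := by
        obtain ⟨d, -, hd⟩ := EReal.lt_iff_exists_real_btwn.1 (bot_lt_iff_ne_bot.2 (hbot (n - m)))
        rw [EReal.eq_top_iff_forall_lt]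
        intro y
        have := hsup m (n - m) (y - d + 1) d (hm ▸ EReal.coe_lt_top _) hd
        rw [Nat.add_sub_cancel' ((le_max_left _ _).trans hn)] at this
        refine lt_of_lt_of_le (EReal.coe_lt_coe_iff.2 ?_) this
        linarith
      have hn' : (0 : ℝ) < n := by exact_mod_cast (le_max_right m 1).trans hn
      rw [hfn, EReal.coe_mul_top_of_pos (inv_pos.2 hn')]
    have h2 : (⨆ (n : ℕ) (_ : 1 ≤ n), (((n : ℝ)⁻¹ : ℝ) : EReal) * f n) = ⊤ :=
      top_le_iff.1 ((h1 _ le_rfl).ge.trans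
        (le_iSup₂ (f := fun (n : ℕ) (_ : 1 ≤ n) => (((n : ℝ)⁻¹ : ℝ) : EReal) * f n)
          (max m 1) (le_max_right _ _)))
    rw [h2]
    exact tendsto_const_nhds.congr' (Filter.eventually_atTop.2 ⟨_, fun n hn => (h1 n hn).symm⟩)
  · push Not at htop
    lift f to ℕ → ℝ using fun n => ⟨htop n, hbot n⟩ with u
    have hsub : Subadditive fun n => -u n := by
      intro m n
      have : u m + u n ≤ u (m + n) := by
        refine le_of_forall_pos_le_add fun ε hε => ?_
        have := hsup m n (u m - ε / 2) (u n - ε / 2) (EReal.coe_lt_coe_iff.2 (by linarith))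
          (EReal.coe_lt_coe_iff.2 (by linarith))
        have := EReal.coe_le_coe_iff.1 this
        linarith
      linarith
    refine tendsto_order.2 ⟨fun l hl => ?_, fun L hL => ?_⟩
    · obtain ⟨n, hn⟩ := lt_iSup_iff.1 hl
      obtain ⟨hn1, hn⟩ := lt_iSup_iff.1 hn
      obtain ⟨y, hly, hy⟩ := EReal.lt_iff_exists_real_btwn.1 hn
      rw [← EReal.coe_mul, EReal.coe_lt_coe_iff, inv_mul_eq_div] at hy
      have := hsub.eventually_div_lt_of_div_lt (L := -y) (n := n) (by omega)
        (by rw [neg_div]; linarith)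
      filter_upwards [this] with p hp
      refine hly.trans ?_
      rw [← EReal.coe_mul, EReal.coe_lt_coe_iff, inv_mul_eq_div]
      rw [neg_div] at hp
      linarith
    · filter_upwards [Filter.eventually_ge_atTop 1] with n hn
      exact (le_iSup₂ (f := fun (n : ℕ) (_ : 1 ≤ n) => (((n : ℝ)⁻¹ : ℝ) : EReal) * (u n : EReal))
        n hn).trans_lt hL

end Fekete

/-! ### Kraus representations, positivity and trace preservation. -/

section Positivity

variable {p b r : Type*} [Fintype p]

/-- `Φ` has an operator-sum representation `X ↦ ∑ᵤ Kᵤ X Kᵤᴴ`. -/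
def HasKraus (Φ : Matrix p p ℂ →ₗ[ℂ] Matrix b b ℂ) : Prop :=
  ∃ (n : ℕ) (K : Fin n → Matrix b p ℂ), ∀ X, Φ X = ∑ u, K u * X * (K u)ᴴ

theorem HasKraus.of_fintype {Φ : Matrix p p ℂ →ₗ[ℂ] Matrix b b ℂ} {U : Type*} [Fintype U]
    (K : U → Matrix b p ℂ) (h : ∀ X, Φ X = ∑ u, K u * X * (K u)ᴴ) : HasKraus Φ :=
  ⟨Fintype.card U, fun i => K ((Fintype.equivFin U).symm i), fun X => by
    rw [h, ← (Fintype.equivFin U).symm.sum_comp]⟩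

theorem HasKraus.tensorPow [DecidableEq p] {Φ : Matrix p p ℂ →ₗ[ℂ] Matrix b b ℂ} (h : HasKraus Φ)
    (n : ℕ) : HasKraus (tensorPow Φ n) := by
  obtain ⟨m, K, hK⟩ := h
  refine HasKraus.of_fintype (U := Fin n → Fin m)
    (fun u => Matrix.of fun i k => ∏ t, K (u t) (i t) (k t)) fun X => ?_
  have hent : ∀ (k l : p) (i j : b), Φ (Matrix.single k l 1) i j =
      ∑ u, K u i k * star (K u j l) := by
    intro k l i j
    rw [hK]
    simp [Matrix.sum_apply, Matrix.mul_apply, Matrix.single_apply, ite_and]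
  ext i j
  simp only [JammerChannel.tensorPow, LinearMap.coe_mk, AddHom.coe_mk, Matrix.of_apply, hent,
    Finset.prod_univ_sum, Fintype.piFinset_univ, Matrix.sum_apply, Matrix.mul_apply,
    Matrix.conjTranspose_apply, Finset.prod_mul_distrib, star_prod, Finset.sum_mul, Finset.mul_sum]
  rw [Finset.sum_comm]
  simp only [Finset.sum_comm (s := (Finset.univ : Finset (Fin n → p)))
    (t := (Finset.univ : Finset (Fin n → Fin m)))]
  refine Finset.sum_congr rfl fun u _ => Finset.sum_congr rfl fun k _ =>
    Finset.sum_congr rfl fun l _ => ?_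
  ring

variable [Fintype b]

theorem posSemidef_of_cstarMatrix_nonneg [DecidableEq p] [DecidableEq b]
    {A : CStarMatrix p p (Matrix b b ℂ)} (hA : 0 ≤ A) :
    (Matrix.of fun i j : p × b => A i.1 j.1 i.2 j.2).PosSemidef := by
  have h := StarOrderedRing.nonneg_iff.1 hA
  induction h using AddSubmonoid.closure_induction with
  | mem x hx =>
    obtain ⟨s, rfl⟩ := hx
    convert! Matrix.posSemidef_conjTranspose_mul_self
      (Matrix.of fun i j : p × b => s i.1 j.1 i.2 j.2) using 1
    ext i j
    simp [CStarMatrix.mul_apply, CStarMatrix.star_apply, Matrix.star_eq_conjTranspose,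
      Matrix.sum_apply, Matrix.mul_apply, Fintype.sum_prod_type]
  | zero => exact Matrix.PosSemidef.zero
  | add x y hx hy h1 h2 =>
    exact (h1 (StarOrderedRing.nonneg_iff.2 hx)).add (h2 (StarOrderedRing.nonneg_iff.2 hy))

/-- Choi's argument: the Choi matrix is positive, and the rows of a factor `C` with Choi matrix `Cᴴ
* C` give the Kraus operators. -/
theorem hasKraus_of_completelyPositive [DecidableEq p] [DecidableEq b]
    (Φ : Matrix p p ℂ →CP Matrix b b ℂ) : HasKraus Φ.toLinearMap := by
  by_cases hp : Nonempty p
  swap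
  · refine HasKraus.of_fintype (U := Fin 0) (fun _ => 0) fun X => ?_
    have : IsEmpty p := not_nonempty_iff.1 hp
    simp [Subsingleton.elim X 0]
  obtain ⟨k0⟩ := hp
  -- Only row `k0` is nonzero; `star V * V` is the block matrix of all matrix units, hence positive.
  set V : CStarMatrix p p (Matrix p p ℂ) :=
    CStarMatrix.ofMatrix (Matrix.of fun k l => if k = k0 then Matrix.single k0 l 1 else 0) with hV
  have hC : ∀ k l, (star V * V) k l = Matrix.single k l 1 := by
    intro k l
    simp [CStarMatrix.mul_apply, CStarMatrix.star_apply, hV, Matrix.star_eq_conjTranspose]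
  have hpos := posSemidef_of_cstarMatrix_nonneg
    (Φ.map_cstarMatrix_nonneg (star V * V) (star_mul_self_nonneg V))
  obtain ⟨C, hC'⟩ := CStarAlgebra.nonneg_iff_eq_star_mul_self.1 hpos.nonneg
  refine HasKraus.of_fintype (U := p × b)
    (fun u => Matrix.of fun i k => star (C u (k, i))) fun X => ?_
  have hent : ∀ k l i j, Φ.toLinearMap (Matrix.single k l 1) i j =
      ∑ u, star (C u (k, i)) * C u (l, j) := by
    intro k l i j
    have := congrFun (congrFun hC' (k, i)) (l, j)
    rw [Matrix.of_apply, CStarMatrix.map_apply, hC] at this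
    exact this
  ext i j
  conv_lhs => rw [Matrix.matrix_eq_sum_single X]
  have hX : ∀ k l, Φ.toLinearMap (Matrix.single k l (X k l)) i j =
      ∑ u, star (C u (k, i)) * X k l * C u (l, j) := by
    intro k l
    rw [← mul_one (X k l), ← smul_eq_mul, ← Matrix.smul_single, map_smul, Matrix.smul_apply, hent,
      Finset.smul_sum]
    refine Finset.sum_congr rfl fun u _ => ?_
    simp only [smul_eq_mul, mul_one]
    ring
  simp only [map_sum, Matrix.sum_apply, hX, Matrix.mul_apply, Matrix.conjTranspose_apply,
    Matrix.of_apply, star_star, Finset.sum_mul]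
  rw [Finset.sum_comm]
  simp only [Finset.sum_comm (s := (Finset.univ : Finset p)) (t := (Finset.univ : Finset (p × b)))]

theorem HasKraus.ampliate_posSemidef {Φ : Matrix p p ℂ →ₗ[ℂ] Matrix b b ℂ} (h : HasKraus Φ)
    [Fintype r] {X : Matrix (p × r) (p × r) ℂ} (hX : X.PosSemidef) :
    (ampliate r Φ X).PosSemidef := by
  classical
  obtain ⟨n, K, hK⟩ := h
  have : ampliate r Φ X = ∑ u, (K u ⊗ₖ (1 : Matrix r r ℂ)) * X * (K u ⊗ₖ (1 : Matrix r r ℂ))ᴴ := by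
    ext i j
    simp [ampliate, hK, Matrix.sum_apply, Matrix.mul_apply, Fintype.sum_prod_type,
      Matrix.one_apply, Finset.sum_mul, apply_ite (starRingEnd ℂ)]
  rw [this]
  exact Matrix.posSemidef_sum _ fun u _ => hX.mul_mul_conjTranspose_same _

theorem IsTracePreserving.tensorPow [DecidableEq p] {Φ : Matrix p p ℂ →ₗ[ℂ] Matrix b b ℂ}
    (h : IsTracePreserving Φ) (n : ℕ) : IsTracePreserving (tensorPow Φ n) := by
  intro X
  have hent : ∀ k l : p, ∑ i, Φ (Matrix.single k l 1) i i = if k = l then 1 else 0 := by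
    intro k l
    have := h (Matrix.single k l 1)
    rw [Matrix.trace] at this
    simp only [Matrix.diag] at this
    rw [this]
    split_ifs with hkl
    · rw [hkl, Matrix.trace_single_eq_same]
    · rw [Matrix.trace_single_eq_of_ne _ _ _ hkl]
  simp only [JammerChannel.tensorPow, LinearMap.coe_mk, AddHom.coe_mk, Matrix.of_apply,
    Matrix.trace, Matrix.diag]
  rw [Finset.sum_comm]
  refine Finset.sum_congr rfl fun k _ => ?_
  rw [Finset.sum_comm]
  have : ∀ l : Fin n → p, ∑ i : Fin n → b, X k l * ∏ t, Φ (Matrix.single (k t) (l t) 1) (i t) (i t)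
      = X k l * if k = l then 1 else 0 := by
    intro l
    rw [← Finset.mul_sum, ← Fintype.piFinset_univ, ← Finset.prod_univ_sum
      (fun _ => Finset.univ) (fun t i => Φ (Matrix.single (k t) (l t) 1) i i)]
    simp only [hent]
    congr 1
    split_ifs with hkl
    · simp [hkl]
    · obtain ⟨t, ht⟩ := Function.ne_iff.1 hkl
      exact Finset.prod_eq_zero (Finset.mem_univ t) (by simp [ht])
  simp [this]

theorem trace_ampliate [Fintype r] {Φ : Matrix p p ℂ →ₗ[ℂ] Matrix b b ℂ} (h : IsTracePreserving Φ)
    (X : Matrix (p × r) (p × r) ℂ) : (ampliate r Φ X).trace = X.trace := by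
  simp only [Matrix.trace, Matrix.diag, Fintype.sum_prod_type_right]
  refine Finset.sum_congr rfl fun y _ => ?_
  exact h (Matrix.of fun k l => X (k, y) (l, y))

end Positivity

section ChannelPow

variable {a e b : Type*} [Fintype a] [DecidableEq a] [Fintype e] [DecidableEq e]

theorem HasKraus.channelPow {Φ : Matrix (a × e) (a × e) ℂ →ₗ[ℂ] Matrix b b ℂ} (h : HasKraus Φ)
    (n : ℕ) : HasKraus (channelPow Φ n) := by
  obtain ⟨m, K, hK⟩ := h.tensorPow n
  refine ⟨m, fun u => (K u).submatrix id
    (Equiv.arrowProdEquivProdArrow (Fin n) (fun _ => a) (fun _ => e)).symm, fun X => ?_⟩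
  simp only [JammerChannel.channelPow, LinearMap.comp_apply, hK]
  refine Finset.sum_congr rfl fun u _ => ?_
  ext i j
  simp only [Matrix.mul_apply]
  simp only [Finset.sum_mul]
  rw [← (Equiv.arrowProdEquivProdArrow (Fin n) (fun _ => a) (fun _ => e)).symm.sum_comp]
  refine Finset.sum_congr rfl fun k _ => ?_
  rw [← (Equiv.arrowProdEquivProdArrow (Fin n) (fun _ => a) (fun _ => e)).symm.sum_comp]
  simp

theorem IsTracePreserving.channelPow [Fintype b]
    {Φ : Matrix (a × e) (a × e) ℂ →ₗ[ℂ] Matrix b b ℂ}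
    (h : IsTracePreserving Φ) (n : ℕ) : IsTracePreserving (channelPow Φ n) := by
  intro X
  simp only [JammerChannel.channelPow, LinearMap.comp_apply, h.tensorPow n _]
  simp only [Matrix.trace, Matrix.diag]
  rw [← (Equiv.arrowProdEquivProdArrow (Fin n) (fun _ => a) (fun _ => e)).symm.sum_comp]
  simp

end ChannelPow

/-! ### Measured divergences of positive operators. -/

section Measurement

theorem trace_mul_nonneg {d : Type*} [Fintype d] {A B : Matrix d d ℂ} (hA : A.PosSemidef)
    (hB : B.PosSemidef) : 0 ≤ (A * B).trace := by
  classical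
  obtain ⟨C, rfl⟩ := CStarAlgebra.nonneg_iff_eq_star_mul_self.1 hB.nonneg
  rw [← mul_assoc, Matrix.trace_mul_comm, ← mul_assoc]
  exact (hA.mul_mul_conjTranspose_same C).trace_nonneg

variable {x d : Type*} [Fintype x] [Fintype d] [DecidableEq d] {M : x → Matrix d d ℂ}

theorem measuredDist_nonneg (hM : IsPOVM M) {ρ : Matrix d d ℂ} (hρ : ρ.PosSemidef) (i : x) :
    0 ≤ measuredDist M ρ i :=
  (Complex.le_def.1 (trace_mul_nonneg (hM.1 i) hρ)).1

theorem sum_measuredDist (hM : IsPOVM M) (ρ : Matrix d d ℂ) :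
    ∑ i, measuredDist M ρ i = ρ.trace.re := by
  simp only [measuredDist]
  rw [← Complex.re_sum, ← Matrix.trace_sum, ← Finset.sum_mul, hM.2, one_mul]

theorem lt_measuredRenyiDiv_iff {d : Type u} [Fintype d] [DecidableEq d] {α : ℝ} (h0 : 0 < α)
    (h1 : α < 1) {ρ σ : Matrix d d ℂ} (hρ : ρ.PosSemidef) (hσ : σ.PosSemidef) (c : ℝ) :
    (c : EReal) < measuredRenyiDiv α d ρ σ ↔ ∃ (m : ℕ) (M : Fin m → Matrix d d ℂ), IsPOVM M ∧
      renyiSum α (measuredDist M ρ) (measuredDist M σ) < Real.exp ((α - 1) * c) := by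
  simp only [measuredRenyiDiv, lt_iSup_iff]
  refine exists_congr fun m => exists_congr fun M => ?_
  rw [← exists_prop]
  exact exists_congr fun hM =>
    lt_classicalRenyi_iff h0 h1 (measuredDist_nonneg hM hρ) (measuredDist_nonneg hM hσ) c

/-- Arbitrary finite outcome types are allowed, as adaptive measurements have a sigma type of
outcomes. -/
theorem lt_measuredRenyiDiv {d : Type u} [Fintype d] [DecidableEq d] {α : ℝ} (h0 : 0 < α)
    (h1 : α < 1) {ρ σ : Matrix d d ℂ} (hρ : ρ.PosSemidef) (hσ : σ.PosSemidef) {c : ℝ}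
    {M : x → Matrix d d ℂ} (hM : IsPOVM M)
    (h : renyiSum α (measuredDist M ρ) (measuredDist M σ) < Real.exp ((α - 1) * c)) :
    (c : EReal) < measuredRenyiDiv α d ρ σ := by
  let f := (Fintype.equivFin x).symm
  refine (lt_measuredRenyiDiv_iff h0 h1 hρ hσ c).2
    ⟨Fintype.card x, M ∘ f, ⟨fun i => hM.1 _, ?_⟩, lt_of_eq_of_lt ?_ h⟩
  · rw [← hM.2]
    exact f.sum_comp M
  · exact f.sum_comp fun i => measuredDist M ρ i ^ α * measuredDist M σ i ^ (1 - α)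

theorem measuredRenyiDiv_mono {d : Type u} [Fintype d] [DecidableEq d] {α β : ℝ} (h0 : 0 < α)
    (h : α ≤ β) (h1 : β < 1) {ρ σ : Matrix d d ℂ} (hρ : IsDensity ρ) (hσ : σ.PosSemidef) :
    measuredRenyiDiv α d ρ σ ≤ measuredRenyiDiv β d ρ σ :=
  iSup_mono fun _ => iSup_mono fun _ => iSup_mono fun hM =>
    classicalRenyi_mono h0 h h1 (measuredDist_nonneg hM hρ.1)
      (by rw [sum_measuredDist hM, hρ.2, Complex.one_re]) (measuredDist_nonneg hM hσ)

theorem measuredRenyiDiv_le {d : Type u} [Fintype d] [DecidableEq d] {α : ℝ} (h0 : 0 < α)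
    (h1 : α < 1) {ρ σ : Matrix d d ℂ} (hρ : IsDensity ρ) (hσ : σ.PosSemidef) :
    measuredRenyiDiv α d ρ σ ≤ measuredDiv d ρ σ :=
  iSup_mono fun _ => iSup_mono fun _ => iSup_mono fun hM =>
    classicalRenyi_le_relEntropy h0 h1 (measuredDist_nonneg hM hρ.1)
      (by rw [sum_measuredDist hM, hρ.2, Complex.one_re]) (measuredDist_nonneg hM hσ)

theorem exists_lt_measuredRenyiDiv {d : Type u} [Fintype d] [DecidableEq d]
    {ρ σ : Matrix d d ℂ} (hρ : IsDensity ρ) (hσ : σ.PosSemidef) {c : ℝ}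
    (hc : (c : EReal) < measuredDiv d ρ σ) :
    ∃ α ∈ Set.Ioo (0 : ℝ) 1, (c : EReal) < measuredRenyiDiv α d ρ σ := by
  simp only [measuredDiv, lt_iSup_iff] at hc
  obtain ⟨m, M, hM, hc⟩ := hc
  obtain ⟨α, hα, h⟩ := exists_lt_classicalRenyi (measuredDist_nonneg hM hρ.1)
    (by rw [sum_measuredDist hM, hρ.2, Complex.one_re]) (measuredDist_nonneg hM hσ) hc
  refine ⟨α, hα, ?_⟩
  simp only [measuredRenyiDiv, lt_iSup_iff]
  exact ⟨m, M, hM, h⟩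

end Measurement

/-! ### Compactness and normalization of states. -/

section Density

variable {d : Type*} [Fintype d]

/-- States are the image of the compact Frobenius unit sphere under `C ↦ Cᴴ * C`. -/
theorem isCompact_setOf_isDensity : IsCompact {ρ : Matrix d d ℂ | IsDensity ρ} := by
  classical
  have hK : IsCompact {C : Matrix d d ℂ | (Cᴴ * C).trace = 1} := by
    refine IsCompact.of_isClosed_subset (s := Set.pi Set.univ fun _ : d =>
      Set.pi Set.univ fun _ : d => Metric.closedBall (0 : ℂ) 1)
      (isCompact_univ_pi fun _ => isCompact_univ_pi fun _ => isCompact_closedBall _ _) ?_ ?_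
    · exact isClosed_eq (by fun_prop) continuous_const
    · intro (C : Matrix d d ℂ) hC i _ j _
      have hC : ∑ y, ∑ z, ‖C z y‖ ^ 2 = 1 := by
        have hC : (Cᴴ * C).trace = 1 := hC
        simp only [Matrix.trace, Matrix.diag, Matrix.mul_apply, Matrix.conjTranspose_apply,
          RCLike.star_def, Complex.conj_mul'] at hC
        exact_mod_cast hC
      have h1 : ‖C i j‖ ^ 2 ≤ 1 := by
        rw [← hC]
        refine (Finset.single_le_sum (f := fun z => ‖C z j‖ ^ 2) (fun _ _ => sq_nonneg _)
          (Finset.mem_univ i)).trans (Finset.single_le_sum (f := fun y => ∑ z, ‖C z y‖ ^ 2)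
          (fun _ _ => Finset.sum_nonneg fun _ _ => sq_nonneg _) (Finset.mem_univ j))
      rw [mem_closedBall_zero_iff]
      exact (sq_le_one_iff₀ (norm_nonneg _)).1 h1
  convert hK.image (f := fun C => Cᴴ * C) (by fun_prop) using 1
  ext ρ
  constructor
  · rintro ⟨h, h1⟩
    obtain ⟨C, rfl⟩ := CStarAlgebra.nonneg_iff_eq_star_mul_self.1 h.nonneg
    exact ⟨C, h1, rfl⟩
  · rintro ⟨C, hC, rfl⟩
    exact ⟨Matrix.posSemidef_conjTranspose_mul_self C, hC⟩

theorem exists_isDensity [Nonempty d] : ∃ ρ : Matrix d d ℂ, IsDensity ρ := by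
  classical
  obtain ⟨i⟩ := ‹Nonempty d›
  refine ⟨Matrix.single i i 1, ?_, Matrix.trace_single_eq_same _ _⟩
  have : Matrix.single i i (1 : ℂ) = (Matrix.single i i 1)ᴴ * Matrix.single i i 1 := by simp
  rw [this]
  exact Matrix.posSemidef_conjTranspose_mul_self _

theorem exists_isDensity_eq_smul [Nonempty d] {ρ : Matrix d d ℂ} (h : ρ.PosSemidef) :
    ∃ σ, IsDensity σ ∧ ρ = (ρ.trace.re : ℂ) • σ := by
  classical
  have htr : ((ρ.trace.re : ℝ) : ℂ) = ρ.trace :=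
    (Complex.ext rfl (Complex.le_def.1 h.trace_nonneg).2)
  by_cases h0 : ρ.trace = 0
  · obtain ⟨σ, hσ⟩ := exists_isDensity (d := d)
    refine ⟨σ, hσ, ?_⟩
    rw [htr, h0, zero_smul]
    exact h.trace_eq_zero_iff.1 h0
  · refine ⟨ρ.trace⁻¹ • ρ, ⟨h.smul (inv_nonneg.2 h.trace_nonneg), ?_⟩, ?_⟩
    · rw [Matrix.trace_smul, smul_eq_mul, inv_mul_cancel₀ h0]
    · rw [htr, smul_smul, mul_inv_cancel₀ h0, one_smul]

end Density

section JammedOutput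

variable {a e b r : Type*}

/-- The operator `jammedOutput Φ ρ σ` as a linear function of `σ`. -/
def jammedOutputLin (Φ : Matrix (a × e) (a × e) ℂ →ₗ[ℂ] Matrix b b ℂ)
    (ρ : Matrix (a × r) (a × r) ℂ) : Matrix e e ℂ →ₗ[ℂ] Matrix (b × r) (b × r) ℂ where
  toFun := jammedOutput Φ ρ
  map_add' σ τ := by
    rw [jammedOutput, jammedOutput, jammedOutput, ← map_add, Matrix.kronecker_add]
    rfl
  map_smul' c σ := by
    rw [jammedOutput, jammedOutput, Matrix.kronecker_smul, RingHom.id_apply, ← map_smul]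
    rfl

variable [Fintype e] [Fintype b] [Fintype r]

theorem continuous_measuredDist_jammedOutput {x : Type*}
    (Φ : Matrix (a × e) (a × e) ℂ →ₗ[ℂ] Matrix b b ℂ) (ρ : Matrix (a × r) (a × r) ℂ)
    (M : x → Matrix (b × r) (b × r) ℂ) (i : x) :
    Continuous fun σ => measuredDist M (jammedOutput Φ ρ σ) i := by
  have h : Continuous (jammedOutputLin Φ ρ) := LinearMap.continuous_of_finiteDimensional _
  exact Complex.continuous_re.comp (continuous_const.matrix_mul h).matrix_trace

theorem continuous_renyiSum_jammedOutput {x : Type*} [Fintype x] {α : ℝ} (h0 : 0 < α) (h1 : α < 1)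
    (N M : Matrix (a × e) (a × e) ℂ →ₗ[ℂ] Matrix b b ℂ) (ρ : Matrix (a × r) (a × r) ℂ)
    (T : x → Matrix (b × r) (b × r) ℂ) :
    Continuous fun s : Matrix e e ℂ × Matrix e e ℂ =>
      renyiSum α (measuredDist T (jammedOutput N ρ s.1)) (measuredDist T (jammedOutput M ρ s.2)) :=
  continuous_finsetSum _ fun i _ =>
    (((continuous_measuredDist_jammedOutput N ρ T i).comp continuous_fst).rpow_const
      fun _ => Or.inr h0.le).mul
    (((continuous_measuredDist_jammedOutput M ρ T i).comp continuous_snd).rpow_const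
      fun _ => Or.inr (by linarith))

variable [Fintype a]

theorem HasKraus.jammedOutput_posSemidef {Φ : Matrix (a × e) (a × e) ℂ →ₗ[ℂ] Matrix b b ℂ}
    (h : HasKraus Φ) {ρ : Matrix (a × r) (a × r) ℂ} (hρ : ρ.PosSemidef) {σ : Matrix e e ℂ}
    (hσ : σ.PosSemidef) : (jammedOutput Φ ρ σ).PosSemidef :=
  h.ampliate_posSemidef ((hρ.kronecker hσ).submatrix _)

theorem isDensity_jammedOutput {Φ : Matrix (a × e) (a × e) ℂ →ₗ[ℂ] Matrix b b ℂ}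
    (h : HasKraus Φ) (hΦ : IsTracePreserving Φ) {ρ : Matrix (a × r) (a × r) ℂ} (hρ : IsDensity ρ)
    {σ : Matrix e e ℂ} (hσ : IsDensity σ) : IsDensity (jammedOutput Φ ρ σ) := by
  refine ⟨h.jammedOutput_posSemidef hρ.1 hσ.1, ?_⟩
  rw [jammedOutput, trace_ampliate hΦ]
  have := Matrix.trace_kronecker ρ σ
  rw [hρ.2, hσ.2, one_mul] at this
  rw [← this]
  simp only [Matrix.trace, Matrix.diag, Fintype.sum_prod_type, Matrix.submatrix_apply]
  exact Finset.sum_congr rfl fun _ _ => Finset.sum_comm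

end JammedOutput

/-! ### Exhaustion by orders below one, for a single pair of maps. -/

section Minimax

variable {a e : Type*} {b : Type u} [Fintype a] [Fintype e] [Fintype b] [DecidableEq b]
  {N M : Matrix (a × e) (a × e) ℂ →ₗ[ℂ] Matrix b b ℂ}

theorem minimaxDiv_mono {D D' : DivFunctional.{u}} (hN : HasKraus N) (hN' : IsTracePreserving N)
    (hM : HasKraus M) (h : ∀ (d : Type u) [Fintype d] [DecidableEq d] (ρ σ : Matrix d d ℂ),
      IsDensity ρ → σ.PosSemidef → D d ρ σ ≤ D' d ρ σ) :
    minimaxDiv D N M ≤ minimaxDiv D' N M :=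
  iSup_mono fun _ => iSup_mono fun _ => iSup_mono fun hρ => iInf_mono fun _ => iInf_mono fun hσ =>
    iInf_mono fun _ => iInf_mono fun hω => h _ _ _ (isDensity_jammedOutput hN hN' hρ hσ)
      (hM.jammedOutput_posSemidef hρ.1 hω.1)

/-- On one channel use, the measured Rényi divergences exhaust the measured relative entropy: the
supremum over the order can be taken out of the infimum over the compact set of pairs of states. -/
theorem exists_lt_minimaxDiv_measuredRenyiDiv (hN : HasKraus N) (hN' : IsTracePreserving N)
    (hM : HasKraus M) {c : ℝ} (hc : (c : EReal) < minimaxDiv measuredDiv N M) :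
    ∃ α ∈ Set.Ioo (0 : ℝ) 1, (c : EReal) ≤ minimaxDiv (measuredRenyiDiv α) N M := by
  classical
  simp only [minimaxDiv, lt_iSup_iff] at hc
  obtain ⟨k, ρ, hρ, hc⟩ := hc
  let U : Set.Ioo (0 : ℝ) 1 → Set (Matrix e e ℂ × Matrix e e ℂ) := fun α =>
    ⋃ (m : ℕ) (T : Fin m → Matrix (b × Fin k) (b × Fin k) ℂ) (_ : IsPOVM T), {s |
      renyiSum α.1 (measuredDist T (jammedOutput N ρ s.1)) (measuredDist T (jammedOutput M ρ s.2)) <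
        Real.exp ((α.1 - 1) * c)}
  have hU : ∀ α, IsOpen (U α) := fun α =>
    isOpen_iUnion fun m => isOpen_iUnion fun T => isOpen_iUnion fun _ =>
      isOpen_lt (continuous_renyiSum_jammedOutput α.2.1 α.2.2 N M ρ T) continuous_const
  have hmem : ∀ (α : Set.Ioo (0 : ℝ) 1) (σ ω : Matrix e e ℂ), IsDensity σ → IsDensity ω →
      ((σ, ω) ∈ U α ↔ (c : EReal) <
        measuredRenyiDiv α.1 (b × Fin k) (jammedOutput N ρ σ) (jammedOutput M ρ ω)) := by
    intro α σ ω hσ hω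
    rw [lt_measuredRenyiDiv_iff α.2.1 α.2.2 (hN.jammedOutput_posSemidef hρ.1 hσ.1)
      (hM.jammedOutput_posSemidef hρ.1 hω.1)]
    simp [U]
  have hK := (isCompact_setOf_isDensity (d := e)).prod (isCompact_setOf_isDensity (d := e))
  have : Nonempty (Set.Ioo (0 : ℝ) 1) := ⟨⟨1 / 2, by norm_num, by norm_num⟩⟩
  -- The union over `β ≤ α` makes the cover directed by construction; monotonicity in the order is
  -- only available at states.
  obtain ⟨α, hα⟩ := hK.elim_directed_cover
    (fun α : Set.Ioo (0 : ℝ) 1 => ⋃ (β : Set.Ioo (0 : ℝ) 1) (_ : β ≤ α), U β)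
    (fun α => isOpen_iUnion fun β => isOpen_iUnion fun _ => hU β) (by
      rintro ⟨σ, ω⟩ ⟨hσ, hω⟩
      have h : (c : EReal) < measuredDiv (b × Fin k) (jammedOutput N ρ σ) (jammedOutput M ρ ω) :=
        hc.trans_le ((iInf₂_le σ hσ).trans (iInf₂_le ω hω))
      obtain ⟨α, hα, h⟩ := exists_lt_measuredRenyiDiv (isDensity_jammedOutput hN hN' hρ hσ)
        (hM.jammedOutput_posSemidef hρ.1 hω.1) h
      exact Set.mem_iUnion.2 ⟨⟨α, hα⟩, Set.mem_iUnion₂.2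
        ⟨⟨α, hα⟩, le_rfl, (hmem ⟨α, hα⟩ σ ω hσ hω).2 h⟩⟩)
    (Monotone.directed_le fun α β h => Set.iUnion₂_subset fun γ hγ =>
      Set.subset_iUnion₂_of_subset γ (hγ.trans h) subset_rfl)
  refine ⟨α.1, α.2, ?_⟩
  refine le_iSup_of_le k (le_iSup_of_le ρ (le_iSup_of_le hρ ?_))
  refine le_iInf₂ fun σ hσ => le_iInf₂ fun ω hω => ?_
  obtain ⟨β, hβ, hs⟩ := Set.mem_iUnion₂.1 (hα (Set.mk_mem_prod hσ hω))
  exact ((hmem β σ ω hσ hω).1 hs).le.trans (measuredRenyiDiv_mono β.2.1 hβ α.2.2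
    (isDensity_jammedOutput hN hN' hρ hσ) (hM.jammedOutput_posSemidef hρ.1 hω.1))

theorem minimaxDiv_measuredDiv_eq (hN : HasKraus N) (hN' : IsTracePreserving N)
    (hM : HasKraus M) : minimaxDiv measuredDiv N M =
      ⨆ α ∈ Set.Ioo (0 : ℝ) 1, minimaxDiv (measuredRenyiDiv α) N M := by
  refine le_antisymm (ereal_le_of_forall_coe_lt fun c hc => ?_)
    (iSup₂_le fun α hα => minimaxDiv_mono hN hN' hM fun d _ _ ρ σ hρ hσ =>
      measuredRenyiDiv_le hα.1 hα.2 hρ hσ)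
  obtain ⟨α, hα, h⟩ := exists_lt_minimaxDiv_measuredRenyiDiv hN hN' hM hc
  exact h.trans (le_iSup₂ (f := fun α (_ : α ∈ Set.Ioo (0 : ℝ) 1) =>
    minimaxDiv (measuredRenyiDiv α) N M) α hα)

/-- The trivial measurement has a Rényi sum bounded on the compact set of state pairs, which bounds
the divergence below uniformly. -/
theorem minimaxDiv_measuredRenyiDiv_ne_bot [Nonempty a] (hN : HasKraus N) (hM : HasKraus M)
    {α : ℝ} (h0 : 0 < α) (h1 : α < 1) : minimaxDiv (measuredRenyiDiv α) N M ≠ ⊥ := by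
  obtain ⟨ρ, hρ⟩ := exists_isDensity (d := a × Fin 1)
  let T : Unit → Matrix (b × Fin 1) (b × Fin 1) ℂ := fun _ => 1
  have hT : IsPOVM T := ⟨fun _ => Matrix.PosSemidef.one, by simp [T]⟩
  have hK := (isCompact_setOf_isDensity (d := e)).prod (isCompact_setOf_isDensity (d := e))
  obtain ⟨B, hB⟩ := hK.bddAbove_image
    (continuous_renyiSum_jammedOutput h0 h1 N M ρ T).continuousOn
  have hpos : (0 : ℝ) < |B| + 1 := by positivity
  set c : ℝ := Real.log (|B| + 1) / (α - 1)
  have hc : Real.exp ((α - 1) * c) = |B| + 1 := by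
    rw [mul_div_cancel₀ _ (by linarith), Real.exp_log hpos]
  refine ne_of_gt ((EReal.bot_lt_coe c).trans_le ?_)
  refine le_iSup_of_le 1 (le_iSup_of_le ρ (le_iSup_of_le hρ ?_))
  refine le_iInf₂ fun σ hσ => le_iInf₂ fun ω hω => le_of_lt ?_
  refine lt_measuredRenyiDiv h0 h1 (hN.jammedOutput_posSemidef hρ.1 hσ.1)
    (hM.jammedOutput_posSemidef hρ.1 hω.1) hT ?_
  rw [hc]
  have := hB ⟨(σ, ω), Set.mk_mem_prod hσ hω, rfl⟩
  exact this.trans_lt ((le_abs_self B).trans_lt (lt_add_one _))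

end Minimax

/-! ### Product operators and slices by a functional. -/

section Product

/-- The operator `X ⊗ Y` on a system that is identified with a composite system by `f`. -/
def prodMat {i i₁ i₂ : Type*} (f : i ≃ i₁ × i₂) (X : Matrix i₁ i₁ ℂ) (Y : Matrix i₂ i₂ ℂ) :
    Matrix i i ℂ :=
  (X ⊗ₖ Y).submatrix f f

/-- The block-wise image of `σ` under a functional on the first tensor factor. -/
def sliceMap {i i₁ i₂ : Type*} (f : i ≃ i₁ × i₂) (φ : Matrix i₁ i₁ ℂ →ₗ[ℂ] ℂ)
    (σ : Matrix i i ℂ) : Matrix i₂ i₂ ℂ :=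
  Matrix.of fun l l' => φ (Matrix.of fun k k' => σ (f.symm (k, l)) (f.symm (k', l')))

/-- The partial trace over the second tensor factor. -/
def marginal {i i₁ i₂ : Type*} [Fintype i₂] (f : i ≃ i₁ × i₂) (σ : Matrix i i ℂ) :
    Matrix i₁ i₁ ℂ :=
  Matrix.of fun k k' => ∑ l, σ (f.symm (k, l)) (f.symm (k', l))

variable {i i₁ i₂ : Type*} (f : i ≃ i₁ × i₂)

variable [Fintype i₂]

theorem trace_sliceMap (φ : Matrix i₁ i₁ ℂ →ₗ[ℂ] ℂ) (σ : Matrix i i ℂ) :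
    (sliceMap f φ σ).trace = φ (marginal f σ) := by
  have : marginal f σ =
      ∑ l, Matrix.of fun k k' => σ (f.symm (k, l)) (f.symm (k', l)) := by
    ext k k'
    simp [marginal, Matrix.sum_apply]
  rw [this, map_sum]
  rfl

/-- A functional that is a product on product operators can be evaluated one factor after the
other. -/
theorem apply_eq_apply_sliceMap {φ : Matrix i₁ i₁ ℂ →ₗ[ℂ] ℂ} {ψ : Matrix i₂ i₂ ℂ →ₗ[ℂ] ℂ}
    {Ψ : Matrix i i ℂ →ₗ[ℂ] ℂ} (h : ∀ X Y, Ψ (prodMat f X Y) = φ X * ψ Y) (σ : Matrix i i ℂ) :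
    Ψ σ = ψ (sliceMap f φ σ) := by
  classical
  have hσ : σ = ∑ l, ∑ l', prodMat f
      (Matrix.of fun k k' => σ (f.symm (k, l)) (f.symm (k', l'))) (Matrix.single l l' 1) := by
    ext j j'
    simp [prodMat, Matrix.sum_apply, Matrix.single_apply, ite_and]
  conv_lhs => rw [hσ]
  conv_rhs => rw [Matrix.matrix_eq_sum_single (sliceMap f φ σ)]
  simp only [map_sum, h]
  refine Finset.sum_congr rfl fun l _ => Finset.sum_congr rfl fun l' _ => ?_
  have hs : Matrix.single l l' (sliceMap f φ σ l l') =
      sliceMap f φ σ l l' • Matrix.single l l' (1 : ℂ) := by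
    rw [Matrix.smul_single, smul_eq_mul, mul_one]
  rw [hs, map_smul]
  rfl

variable [Fintype i] [Fintype i₁]

theorem trace_prodMat_mul (X X' : Matrix i₁ i₁ ℂ) (Y Y' : Matrix i₂ i₂ ℂ) :
    (prodMat f X Y * prodMat f X' Y').trace = (X * X').trace * (Y * Y').trace := by
  rw [prodMat, prodMat, Matrix.submatrix_mul_equiv, ← Matrix.mul_kronecker_mul,
    ← Matrix.trace_kronecker]
  exact f.sum_comp fun j => (_ ⊗ₖ _ : Matrix (i₁ × i₂) (i₁ × i₂) ℂ) j j

theorem IsDensity.prodMat {X : Matrix i₁ i₁ ℂ} {Y : Matrix i₂ i₂ ℂ} (hX : IsDensity X)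
    (hY : IsDensity Y) : IsDensity (prodMat f X Y) := by
  refine ⟨(hX.1.kronecker hY.1).submatrix f, ?_⟩
  rw [← one_mul (1 : ℂ)]
  nth_rw 1 [← hX.2]
  rw [← hY.2, ← Matrix.trace_kronecker]
  exact f.sum_comp fun j => (X ⊗ₖ Y : Matrix (i₁ × i₂) (i₁ × i₂) ℂ) j j

/-- Measuring the first factor and then the second one, with a measurement that may depend on the
first outcome, is a measurement of the composite system. -/
theorem isPOVM_sigma [DecidableEq i] [DecidableEq i₁] [DecidableEq i₂] {x : Type*} [Fintype x]
    {y : x → Type*} [∀ u, Fintype (y u)] {S : x → Matrix i₁ i₁ ℂ} (hS : IsPOVM S)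
    {T : ∀ u, y u → Matrix i₂ i₂ ℂ} (hT : ∀ u, IsPOVM (T u)) :
    IsPOVM fun v : Σ u, y u => JammerChannel.prodMat f (S v.1) (T v.1 v.2) := by
  refine ⟨fun v => ((hS.1 _).kronecker ((hT _).1 _)).submatrix f, ?_⟩
  rw [Fintype.sum_sigma]
  have h : ∀ u, ∑ v, JammerChannel.prodMat f (S u) (T u v) =
      JammerChannel.prodMat f (S u) 1 := by
    intro u
    rw [← (hT u).2]
    ext j k
    simp [JammerChannel.prodMat, Matrix.sum_apply, Finset.mul_sum]
  simp only [h]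
  have : ∑ u, JammerChannel.prodMat f (S u) 1 =
      JammerChannel.prodMat f (∑ u, S u) (1 : Matrix i₂ i₂ ℂ) := by
    ext j k
    simp [JammerChannel.prodMat, Matrix.sum_apply, Finset.sum_mul]
  rw [this, hS.2, JammerChannel.prodMat, Matrix.one_kronecker_one, Matrix.submatrix_one_equiv]

theorem IsDensity.marginal {σ : Matrix i i ℂ} (h : IsDensity σ) :
    IsDensity (marginal f σ) := by
  refine ⟨?_, ?_⟩
  · have : JammerChannel.marginal f σ =
        ∑ l, σ.submatrix (fun k => f.symm (k, l)) fun k => f.symm (k, l) := by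
      ext k k'
      simp [JammerChannel.marginal, Matrix.sum_apply]
    rw [this]
    exact Matrix.posSemidef_sum _ fun l _ => h.1.submatrix _
  · rw [← h.2]
    simp only [Matrix.trace, Matrix.diag, JammerChannel.marginal, Matrix.of_apply]
    rw [← f.symm.sum_comp, Fintype.sum_prod_type]

theorem sliceMap_posSemidef {φ : Matrix i₁ i₁ ℂ →ₗ[ℂ] ℂ} (hφ : ∀ X, X.PosSemidef → 0 ≤ φ X)
    {σ : Matrix i i ℂ} (hσ : σ.PosSemidef) : (sliceMap f φ σ).PosSemidef := by
  classical
  have hquad : ∀ v : i₂ → ℂ, 0 ≤ star v ⬝ᵥ (sliceMap f φ σ *ᵥ v) := by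
    intro v
    -- `V` is `1 ⊗ v`, so the quadratic form of the slice at `v` is `φ (Vᴴ * σ * V)`.
    let V : Matrix i i₁ ℂ := Matrix.of fun j k => if (f j).1 = k then v (f j).2 else 0
    have h := hφ _ (hσ.conjTranspose_mul_mul_same V)
    convert h using 1
    have hV : Vᴴ * σ * V = ∑ l, ∑ l', (star (v l) * v l') •
        Matrix.of fun k k' => σ (f.symm (k, l)) (f.symm (k', l')) := by
      ext k k'
      simp only [Matrix.mul_apply, Matrix.sum_apply, Matrix.smul_apply, Matrix.of_apply,
        Matrix.conjTranspose_apply, V, smul_eq_mul, Finset.sum_mul]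
      rw [Finset.sum_comm]
      rw [← f.symm.sum_comp, Fintype.sum_prod_type_right]
      refine Finset.sum_congr rfl fun l _ => ?_
      rw [Finset.sum_comm]
      rw [← f.symm.sum_comp, Fintype.sum_prod_type_right]
      refine Finset.sum_congr rfl fun l' _ => ?_
      simp [apply_ite (starRingEnd ℂ)]
      ring
    rw [hV]
    simp only [map_sum, map_smul, sliceMap, dotProduct, Matrix.mulVec, Matrix.of_apply,
      Finset.mul_sum, Pi.star_apply, smul_eq_mul]
    exact Finset.sum_congr rfl fun l _ => Finset.sum_congr rfl fun l' _ => by ring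
  refine Matrix.PosSemidef.of_dotProduct_mulVec_nonneg ?_ hquad
  rw [← Matrix.isSymmetric_toEuclideanLin_iff, LinearMap.isSymmetric_iff_inner_map_self_real]
  intro v
  have h := Complex.le_def.1 (hquad v.ofLp)
  rw [Complex.conj_eq_iff_im]
  rw [← inner_conj_symm, Complex.conj_im, neg_eq_zero, EuclideanSpace.inner_eq_star_dotProduct,
    dotProduct_comm]
  exact h.2.symm

end Product

/-! ### Adaptive measurements and superadditivity. -/

section Superadditivity

/-- `Φ` is the tensor product of `Φ₁` and `Φ₂`, for given identifications of its input and output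
systems with composite systems. -/
def FactorsAs {a a₁ a₂ e e₁ e₂ b b₁ b₂ : Type*} (fa : a ≃ a₁ × a₂) (fe : e ≃ e₁ × e₂)
    (fb : b ≃ b₁ × b₂) (Φ : Matrix (a × e) (a × e) ℂ →ₗ[ℂ] Matrix b b ℂ)
    (Φ₁ : Matrix (a₁ × e₁) (a₁ × e₁) ℂ →ₗ[ℂ] Matrix b₁ b₁ ℂ)
    (Φ₂ : Matrix (a₂ × e₂) (a₂ × e₂) ℂ →ₗ[ℂ] Matrix b₂ b₂ ℂ) : Prop :=
  ∀ X Y, Φ (prodMat ((fa.prodCongr fe).trans (Equiv.prodProdProdComm _ _ _ _)) X Y) =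
    prodMat fb (Φ₁ X) (Φ₂ Y)

theorem FactorsAs.jammedOutput {a a₁ a₂ e e₁ e₂ b b₁ b₂ r r₁ r₂ : Type*} {fa : a ≃ a₁ × a₂}
    {fe : e ≃ e₁ × e₂} {fb : b ≃ b₁ × b₂} {Φ : Matrix (a × e) (a × e) ℂ →ₗ[ℂ] Matrix b b ℂ}
    {Φ₁ : Matrix (a₁ × e₁) (a₁ × e₁) ℂ →ₗ[ℂ] Matrix b₁ b₁ ℂ}
    {Φ₂ : Matrix (a₂ × e₂) (a₂ × e₂) ℂ →ₗ[ℂ] Matrix b₂ b₂ ℂ} (h : FactorsAs fa fe fb Φ Φ₁ Φ₂)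
    (fr : r ≃ r₁ × r₂) (ρ₁ : Matrix (a₁ × r₁) (a₁ × r₁) ℂ) (ρ₂ : Matrix (a₂ × r₂) (a₂ × r₂) ℂ)
    (σ₁ : Matrix e₁ e₁ ℂ) (σ₂ : Matrix e₂ e₂ ℂ) :
    jammedOutput Φ (prodMat ((fa.prodCongr fr).trans (Equiv.prodProdProdComm _ _ _ _)) ρ₁ ρ₂)
      (prodMat fe σ₁ σ₂) =
    prodMat ((fb.prodCongr fr).trans (Equiv.prodProdProdComm _ _ _ _)) (jammedOutput Φ₁ ρ₁ σ₁)
      (jammedOutput Φ₂ ρ₂ σ₂) := by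
  ext i j
  simp only [JammerChannel.jammedOutput, ampliate, LinearMap.coe_mk, AddHom.coe_mk,
    Matrix.of_apply]
  have := congrFun (congrFun (h
    (Matrix.of fun k l => ρ₁ (k.1, (fr i.2).1) (l.1, (fr j.2).1) * σ₁ k.2 l.2)
    (Matrix.of fun k l => ρ₂ (k.1, (fr i.2).2) (l.1, (fr j.2).2) * σ₂ k.2 l.2)) i.1) j.1
  refine Eq.trans ?_ (this.trans ?_)
  · refine congrFun (congrFun (congrArg Φ ?_) i.1) j.1
    ext k l
    simp [prodMat, mul_mul_mul_comm]
  · rfl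

variable {a a₁ a₂ e e₁ e₂ : Type*} {b b₁ b₂ : Type u}
  [Fintype a₁] [Fintype e] [Fintype e₁] [Fintype e₂] [Fintype b] [Fintype b₁] [Fintype b₂]
  {fa : a ≃ a₁ × a₂} {fe : e ≃ e₁ × e₂} {fb : b ≃ b₁ × b₂}

/-- Conditioned on an outcome of a measurement of the first output, the second output arises from
some state of the jammer, up to the probability of that outcome. -/
theorem FactorsAs.exists_measuredDist_eq [Nonempty e₂]
    {Φ : Matrix (a × e) (a × e) ℂ →ₗ[ℂ] Matrix b b ℂ}
    {Φ₁ : Matrix (a₁ × e₁) (a₁ × e₁) ℂ →ₗ[ℂ] Matrix b₁ b₁ ℂ}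
    {Φ₂ : Matrix (a₂ × e₂) (a₂ × e₂) ℂ →ₗ[ℂ] Matrix b₂ b₂ ℂ} (h : FactorsAs fa fe fb Φ Φ₁ Φ₂)
    (h₁ : HasKraus Φ₁) {r r₁ r₂ : Type*} [Fintype r] [Fintype r₁] [Fintype r₂]
    (fr : r ≃ r₁ × r₂) {ρ₁ : Matrix (a₁ × r₁) (a₁ × r₁) ℂ} (hρ₁ : ρ₁.PosSemidef)
    (ρ₂ : Matrix (a₂ × r₂) (a₂ × r₂) ℂ) {σ : Matrix e e ℂ} (hσ : IsDensity σ)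
    {S : Matrix (b₁ × r₁) (b₁ × r₁) ℂ} (hS : S.PosSemidef) :
    ∃ τ : Matrix e₂ e₂ ℂ, IsDensity τ ∧ ∀ T : Matrix (b₂ × r₂) (b₂ × r₂) ℂ,
      (prodMat ((fb.prodCongr fr).trans (Equiv.prodProdProdComm _ _ _ _)) S T *
        JammerChannel.jammedOutput Φ
          (prodMat ((fa.prodCongr fr).trans (Equiv.prodProdProdComm _ _ _ _)) ρ₁ ρ₂) σ).trace.re =
      (S * JammerChannel.jammedOutput Φ₁ ρ₁ (marginal fe σ)).trace.re *
        (T * JammerChannel.jammedOutput Φ₂ ρ₂ τ).trace.re := by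
  -- The probability of outcome `S` as a positive functional of the jammer state. The slice of `σ`
  -- by it is the unnormalized conditional state, with trace the outcome probability.
  let φ : Matrix e₁ e₁ ℂ →ₗ[ℂ] ℂ :=
    Matrix.traceLinearMap _ ℂ ℂ ∘ₗ LinearMap.mulLeft ℂ S ∘ₗ jammedOutputLin Φ₁ ρ₁
  have hφ : ∀ X : Matrix e₁ e₁ ℂ, X.PosSemidef → 0 ≤ φ X := fun X hX =>
    trace_mul_nonneg hS (h₁.jammedOutput_posSemidef hρ₁ hX)
  obtain ⟨τ, hτ, hslice⟩ := exists_isDensity_eq_smul (sliceMap_posSemidef fe hφ hσ.1)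
  refine ⟨τ, hτ, fun T => ?_⟩
  let ψ : Matrix e₂ e₂ ℂ →ₗ[ℂ] ℂ :=
    Matrix.traceLinearMap _ ℂ ℂ ∘ₗ LinearMap.mulLeft ℂ T ∘ₗ jammedOutputLin Φ₂ ρ₂
  let Ψ : Matrix e e ℂ →ₗ[ℂ] ℂ :=
    Matrix.traceLinearMap _ ℂ ℂ ∘ₗ LinearMap.mulLeft ℂ
      (prodMat ((fb.prodCongr fr).trans (Equiv.prodProdProdComm _ _ _ _)) S T) ∘ₗ
      jammedOutputLin Φ (prodMat ((fa.prodCongr fr).trans (Equiv.prodProdProdComm _ _ _ _)) ρ₁ ρ₂)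
  have hΨ : ∀ X Y, Ψ (prodMat fe X Y) = φ X * ψ Y := fun X Y => by
    refine Eq.trans ?_ (trace_prodMat_mul
      ((fb.prodCongr fr).trans (Equiv.prodProdProdComm _ _ _ _)) _ _ _ _)
    exact congrArg (fun Z => (prodMat ((fb.prodCongr fr).trans
      (Equiv.prodProdProdComm _ _ _ _)) S T * Z).trace) (h.jammedOutput fr ρ₁ ρ₂ X Y)
  have key := apply_eq_apply_sliceMap fe hΨ σ
  rw [hslice, trace_sliceMap, map_smul, smul_eq_mul] at key
  have := congrArg Complex.re key
  rw [Complex.re_ofReal_mul] at this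
  exact this

variable [Fintype a] [Fintype a₂] [DecidableEq b] [DecidableEq b₁] [DecidableEq b₂]

theorem minimaxDiv_superadditive [Nonempty e₂] {α : ℝ} (h0 : 0 < α) (h1 : α < 1)
    {N M : Matrix (a × e) (a × e) ℂ →ₗ[ℂ] Matrix b b ℂ}
    {N₁ M₁ : Matrix (a₁ × e₁) (a₁ × e₁) ℂ →ₗ[ℂ] Matrix b₁ b₁ ℂ}
    {N₂ M₂ : Matrix (a₂ × e₂) (a₂ × e₂) ℂ →ₗ[ℂ] Matrix b₂ b₂ ℂ}
    (hN : FactorsAs fa fe fb N N₁ N₂) (hM : FactorsAs fa fe fb M M₁ M₂)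
    (kN : HasKraus N) (kM : HasKraus M) (kN₁ : HasKraus N₁) (kM₁ : HasKraus M₁)
    (kN₂ : HasKraus N₂) (kM₂ : HasKraus M₂) {c d : ℝ}
    (hc : (c : EReal) < minimaxDiv (measuredRenyiDiv α) N₁ M₁)
    (hd : (d : EReal) < minimaxDiv (measuredRenyiDiv α) N₂ M₂) :
    ((c + d : ℝ) : EReal) ≤ minimaxDiv (measuredRenyiDiv α) N M := by
  simp only [minimaxDiv, lt_iSup_iff] at hc hd
  obtain ⟨k₁, ρ₁, hρ₁, hc⟩ := hc
  obtain ⟨k₂, ρ₂, hρ₂, hd⟩ := hd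
  let fr : Fin (k₁ * k₂) ≃ Fin k₁ × Fin k₂ := finProdFinEquiv.symm
  have hρ := hρ₁.prodMat ((fa.prodCongr fr).trans (Equiv.prodProdProdComm _ _ _ _)) hρ₂
  refine le_iSup_of_le (k₁ * k₂) (le_iSup_of_le _ (le_iSup_of_le hρ ?_))
  refine le_iInf₂ fun σ hσ => le_iInf₂ fun ω hω => le_of_lt ?_
  have hσ₁ := hσ.marginal fe
  have hω₁ := hω.marginal fe
  have pN₁ := kN₁.jammedOutput_posSemidef hρ₁.1 hσ₁.1
  have pM₁ := kM₁.jammedOutput_posSemidef hρ₁.1 hω₁.1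
  obtain ⟨m, S, hS, hS'⟩ := (lt_measuredRenyiDiv_iff h0 h1 pN₁ pM₁ c).1
    (hc.trans_le ((iInf₂_le _ hσ₁).trans (iInf₂_le _ hω₁)))
  -- Conditional jammer states differ between the two maps, which is harmless because the infimum
  -- runs over independent pairs.
  choose τ hτ hτ' using fun u =>
    hN.exists_measuredDist_eq kN₁ fr hρ₁.1 ρ₂ hσ (hS.1 u)
  choose υ hυ hυ' using fun u =>
    hM.exists_measuredDist_eq kM₁ fr hρ₁.1 ρ₂ hω (hS.1 u)
  have pN₂ := fun u => kN₂.jammedOutput_posSemidef hρ₂.1 (hτ u).1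
  have pM₂ := fun u => kM₂.jammedOutput_posSemidef hρ₂.1 (hυ u).1
  choose l T hT hT' using fun u => (lt_measuredRenyiDiv_iff h0 h1 (pN₂ u) (pM₂ u) d).1
    (hd.trans_le ((iInf₂_le _ (hτ u)).trans (iInf₂_le _ (hυ u))))
  refine lt_measuredRenyiDiv h0 h1 (kN.jammedOutput_posSemidef hρ.1 hσ.1)
    (kM.jammedOutput_posSemidef hρ.1 hω.1)
    (isPOVM_sigma ((fb.prodCongr fr).trans (Equiv.prodProdProdComm _ _ _ _)) hS hT) ?_
  rw [renyiSum, Fintype.sum_sigma, mul_add, Real.exp_add]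
  -- Each inner sum contributes at most the factor `exp ((α - 1) * d)`. Its weight may vanish, so
  -- strictness comes from the outer sum.
  refine (Finset.sum_le_sum (g := fun u =>
    (measuredDist S (jammedOutput N₁ ρ₁ (marginal fe σ)) u ^ α *
      measuredDist S (jammedOutput M₁ ρ₁ (marginal fe ω)) u ^ (1 - α)) *
      Real.exp ((α - 1) * d)) fun u _ => ?_).trans_lt ?_
  · refine le_of_eq_of_le ?_ (mul_le_mul_of_nonneg_left (hT' u).le
      (mul_nonneg (Real.rpow_nonneg (measuredDist_nonneg hS pN₁ u) _)
        (Real.rpow_nonneg (measuredDist_nonneg hS pM₁ u) _)))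
    rw [renyiSum, Finset.mul_sum]
    refine Finset.sum_congr rfl fun v _ => ?_
    refine (congrArg₂ (fun p q : ℝ => p ^ α * q ^ (1 - α)) (hτ' u (T u v)) (hυ' u (T u v))).trans ?_
    change (measuredDist S _ u * measuredDist (T u) _ v) ^ α *
      (measuredDist S _ u * measuredDist (T u) _ v) ^ (1 - α) = _
    rw [Real.mul_rpow (measuredDist_nonneg hS pN₁ u)
      (measuredDist_nonneg (hT u) (pN₂ u) v), Real.mul_rpow (measuredDist_nonneg hS pM₁ u)
      (measuredDist_nonneg (hT u) (pM₂ u) v), mul_mul_mul_comm]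
  rw [← Finset.sum_mul]
  exact mul_lt_mul_of_pos_right hS' (Real.exp_pos _)

end Superadditivity

/-! ### Tensor powers and existence of the limits. -/

section Regularization

theorem factorsAs_channelPow {a e b : Type*} [Fintype a] [DecidableEq a] [Fintype e]
    [DecidableEq e] (Φ : Matrix (a × e) (a × e) ℂ →ₗ[ℂ] Matrix b b ℂ) (m n : ℕ) :
    FactorsAs (Fin.appendEquiv m n).symm (Fin.appendEquiv m n).symm (Fin.appendEquiv m n).symm
      (channelPow Φ (m + n)) (channelPow Φ m) (channelPow Φ n) := by
  intro X Y
  ext i j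
  obtain ⟨⟨i₁, i₂⟩, rfl⟩ := (Fin.appendEquiv m n).surjective i
  obtain ⟨⟨j₁, j₂⟩, rfl⟩ := (Fin.appendEquiv m n).surjective j
  simp only [channelPow, LinearMap.comp_apply, tensorPow, LinearMap.coe_mk, AddHom.coe_mk,
    Matrix.of_apply, prodMat, Matrix.submatrix_apply, Equiv.symm_apply_apply,
    Matrix.kroneckerMap_apply]
  rw [← (Fin.appendEquiv m n).sum_comp, Fintype.sum_prod_type, Finset.sum_mul_sum]
  refine Finset.sum_congr rfl fun k₁ _ => Finset.sum_congr rfl fun k₂ _ => ?_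
  rw [← (Fin.appendEquiv m n).sum_comp, Fintype.sum_prod_type, Finset.sum_mul_sum]
  refine Finset.sum_congr rfl fun l₁ _ => Finset.sum_congr rfl fun l₂ _ => ?_
  simp [Fin.prod_univ_add, mul_mul_mul_comm, Fin.appendEquiv, Equiv.arrowProdEquivProdArrow]

variable {a e : Type*} {b : Type u} [Fintype a] [DecidableEq a] [Fintype e] [DecidableEq e]
  [Fintype b] [DecidableEq b] {N M : Matrix (a × e) (a × e) ℂ →ₗ[ℂ] Matrix b b ℂ}

theorem minimaxDivRate_measuredDiv_eq (hN : HasKraus N) (hN' : IsTracePreserving N)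
    (hM : HasKraus M) {n : ℕ} (hn : 1 ≤ n) : minimaxDivRate measuredDiv N M n =
      ⨆ α ∈ Set.Ioo (0 : ℝ) 1, minimaxDivRate (measuredRenyiDiv α) N M n := by
  have h0 : (0 : ℝ) < (n : ℝ)⁻¹ := inv_pos.2 (by exact_mod_cast hn)
  simp only [minimaxDivRate]
  rw [minimaxDiv_measuredDiv_eq (hN.channelPow n) (hN'.channelPow n) (hM.channelPow n)]
  have h0' : (0 : EReal) < (((n : ℝ)⁻¹ : ℝ) : EReal) := EReal.coe_pos.2 h0
  refine le_antisymm ?_ (iSup₂_le fun α hα => mul_le_mul_of_nonneg_left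
    (le_iSup₂ (f := fun α (_ : α ∈ Set.Ioo (0 : ℝ) 1) =>
      minimaxDiv (measuredRenyiDiv α) (channelPow N n) (channelPow M n)) α hα) h0'.le)
  rw [mul_comm, ← EReal.le_div_iff_mul_le h0' (EReal.coe_ne_top _)]
  refine iSup₂_le fun α hα => ?_
  rw [EReal.le_div_iff_mul_le h0' (EReal.coe_ne_top _), mul_comm]
  exact le_iSup₂ (f := fun α (_ : α ∈ Set.Ioo (0 : ℝ) 1) => (((n : ℝ)⁻¹ : ℝ) : EReal) *
    minimaxDiv (measuredRenyiDiv α) (channelPow N n) (channelPow M n)) α hα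

variable [Nonempty a] [Nonempty e]

theorem tendsto_minimaxDivRate_measuredRenyiDiv (hN : HasKraus N) (hM : HasKraus M) {α : ℝ}
    (hα : α ∈ Set.Ioo (0 : ℝ) 1) :
    Filter.Tendsto (minimaxDivRate (measuredRenyiDiv α) N M) Filter.atTop
      (nhds (⨆ (n : ℕ) (_ : 1 ≤ n), minimaxDivRate (measuredRenyiDiv α) N M n)) :=
  tendsto_iSup_of_superadditive
    (fun n => minimaxDiv_measuredRenyiDiv_ne_bot (hN.channelPow n) (hM.channelPow n) hα.1 hα.2)
    fun m n _ _ hc hd => minimaxDiv_superadditive hα.1 hα.2 (factorsAs_channelPow N m n)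
      (factorsAs_channelPow M m n) (hN.channelPow _) (hM.channelPow _) (hN.channelPow _)
      (hM.channelPow _) (hN.channelPow _) (hM.channelPow _) hc hd

/-- Superadditivity is inherited from the Rényi case: thresholds beaten at orders `α` and `β` are
both beaten at `max α β`. -/
theorem tendsto_minimaxDivRate_measuredDiv (hN : HasKraus N) (hN' : IsTracePreserving N)
    (hM : HasKraus M) :
    Filter.Tendsto (minimaxDivRate measuredDiv N M) Filter.atTop
      (nhds (⨆ (n : ℕ) (_ : 1 ≤ n), minimaxDivRate measuredDiv N M n)) := by
  have hsup := fun n => minimaxDiv_measuredDiv_eq (hN.channelPow n) (hN'.channelPow n)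
    (hM.channelPow n)
  have hle : ∀ n, ∀ α ∈ Set.Ioo (0 : ℝ) 1, minimaxDiv (measuredRenyiDiv α) (channelPow N n)
      (channelPow M n) ≤ minimaxDiv measuredDiv (channelPow N n) (channelPow M n) := by
    intro n α hα
    rw [hsup]
    exact le_iSup₂ (f := fun α (_ : α ∈ Set.Ioo (0 : ℝ) 1) =>
      minimaxDiv (measuredRenyiDiv α) (channelPow N n) (channelPow M n)) α hα
  refine tendsto_iSup_of_superadditive (fun n => ?_) fun m n c d hc hd => ?_
  · have h : (1 / 2 : ℝ) ∈ Set.Ioo (0 : ℝ) 1 := ⟨by norm_num, by norm_num⟩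
    exact ne_bot_of_le_ne_bot (minimaxDiv_measuredRenyiDiv_ne_bot (hN.channelPow n)
      (hM.channelPow n) h.1 h.2) (hle n _ h)
  · rw [hsup] at hc hd
    simp only [lt_iSup_iff] at hc hd
    obtain ⟨α, hα, hc⟩ := hc
    obtain ⟨β, hβ, hd⟩ := hd
    have hγ : max α β ∈ Set.Ioo (0 : ℝ) 1 := ⟨lt_max_of_lt_left hα.1, max_lt hα.2 hβ.2⟩
    refine le_trans (minimaxDiv_superadditive hγ.1 hγ.2 (factorsAs_channelPow N m n)
      (factorsAs_channelPow M m n) (hN.channelPow _) (hM.channelPow _) (hN.channelPow _)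
      (hM.channelPow _) (hN.channelPow _) (hM.channelPow _) (hc.trans_le ?_) (hd.trans_le ?_))
      (hle _ _ hγ)
    · exact minimaxDiv_mono (hN.channelPow m) (hN'.channelPow m) (hM.channelPow m)
        fun d _ _ ρ σ hρ hσ => measuredRenyiDiv_mono hα.1 (le_max_left _ _) hγ.2 hρ hσ
    · exact minimaxDiv_mono (hN.channelPow n) (hN'.channelPow n) (hM.channelPow n)
        fun d _ _ ρ σ hρ hσ => measuredRenyiDiv_mono hβ.1 (le_max_right _ _) hγ.2 hρ hσ

end Regularization

end JammerChannel

theorem mainTheorem8 {a e : Type*} {b : Type u} [Fintype a] [DecidableEq a] [Nonempty a]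
    [Fintype e] [DecidableEq e] [Nonempty e] [Fintype b] [DecidableEq b]
    (N M : Matrix (a × e) (a × e) ℂ →CP Matrix b b ℂ)
    (hN : JammerChannel.IsTracePreserving N.toLinearMap) :
    (∀ α ∈ Set.Ioo (0 : ℝ) 1,
      Filter.Tendsto
        (JammerChannel.minimaxDivRate (JammerChannel.measuredRenyiDiv α)
          N.toLinearMap M.toLinearMap) Filter.atTop
        (nhds (JammerChannel.regMinimaxDiv (JammerChannel.measuredRenyiDiv α)
          N.toLinearMap M.toLinearMap))) ∧
    Filter.Tendsto
      (JammerChannel.minimaxDivRate JammerChannel.measuredDiv N.toLinearMap M.toLinearMap)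
      Filter.atTop
      (nhds (JammerChannel.regMinimaxDiv JammerChannel.measuredDiv
        N.toLinearMap M.toLinearMap)) ∧
    (⨆ α ∈ Set.Ioo (0 : ℝ) 1,
        JammerChannel.regMinimaxDiv (JammerChannel.measuredRenyiDiv α)
          N.toLinearMap M.toLinearMap) =
      JammerChannel.regMinimaxDiv JammerChannel.measuredDiv N.toLinearMap M.toLinearMap := by
  have kN := JammerChannel.hasKraus_of_completelyPositive N
  have kM := JammerChannel.hasKraus_of_completelyPositive M
  have hα := fun α (hα : α ∈ Set.Ioo (0 : ℝ) 1) =>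
    JammerChannel.tendsto_minimaxDivRate_measuredRenyiDiv kN kM hα
  have hD := JammerChannel.tendsto_minimaxDivRate_measuredDiv kN hN kM
  refine ⟨fun α h => tendsto_nhds_limUnder ⟨_, hα α h⟩, tendsto_nhds_limUnder ⟨_, hD⟩, ?_⟩
  rw [JammerChannel.regMinimaxDiv, hD.limUnder_eq]
  have hreg : ∀ α ∈ Set.Ioo (0 : ℝ) 1, JammerChannel.regMinimaxDiv
      (JammerChannel.measuredRenyiDiv α) N.toLinearMap M.toLinearMap = _ :=
    fun α h => (hα α h).limUnder_eq
  -- The suprema over orders and over `n` are exchanged; exhaustion then applies at each `n`.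
  rw [iSup_congr fun α => iSup_congr (hreg α), iSup₂_comm]
  exact iSup_congr fun n => iSup_congr fun hn =>
    (JammerChannel.minimaxDivRate_measuredDiv_eq kN hN kM hn).symm
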